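/- Let $S$ be a countable set and let $(a(i,j))_{i,j\in S}$ be transition rates with $a(i,j)\ge 0$ and $\sum_{j}a(i,j)<\infty$ for every $i\in S$ (no symmetry is assumed). Let $(X_t)_{t\ge 0}$ be a (jointly measurable, e.g. right-continuous) time-homogeneous continuous-time Markov process on $S$ with transition rates $a(i,j)$ and transition probabilities $p_t(j,k)=\mathbb{P}[X_t=k\mid X_0=j]$, where $\sum_k p_t(j,k)=1$, started in a state $i\in S$. Let $L_t=\int_0^t \mathbf 1_{\{X_s=i\}}\,ds$ be its local time in $i$ and let $G_\infty=\int_0^\infty p_t(i,i)\,dt\in[0,\infty]$. Write $h_1\sim h_2$ if $h_1(t)/h_2(t)\to 1$ as $t\to\infty$. Suppose that $p_t(i,i)\sim c\,t^{-\alpha}$ as $t\to\infty$ for some constants $c>0$ and $\alpha>0$. Then for every $\kappa<0$, as $t\to\infty$, $$\mathbb{E}\big[e^{\kappa L_t}\big]\sim\begin{cases}\dfrac{1}{t^{1-\alpha}}\cdot\dfrac{1}{-\kappa\,c\,\Gamma(1-\alpha)\,\Gamma(\alpha)} & \text{if } 0<\alpha<1,\\[2mm] \dfrac{1}{\log t}\cdot\dfrac{1}{-\kappa\,c}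 & \text{if } \alpha=1,\\[2mm] \dfrac{1}{1-\kappa\,G_\infty} & \text{if } \alpha>1,\end{cases}$$ where $\Gamma$ is the Gamma function, and in the case $\alpha>1$ one has $G_\infty<\infty$. -/

import Mathlib

open Filter Topology MeasureTheory Asymptotics
open scoped NNReal ENNReal

noncomputable section

/-- The `Q`-matrix of the jump rates `a`, i.e. the matrix of the generator
`u ↦ (i ↦ ∑ j, a i j * (u j - u i))`. The value of `a i i` plays no role. -/
def rateMatrix {S : Type*} (a : S → S → ℝ) (i j : S) : ℝ :=
  a i j - Set.indicator {i} (fun _ => ∑' k, a i k) j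

/-- `p t i j` are the transition probabilities of a time-homogeneous continuous-time Markov
process on the countable set `S` with transition rates `a`: a stochastic semigroup whose
derivative at time `0` is the `Q`-matrix of `a`. Only finiteness of the total rate out of each
state is required; no symmetry, homogeneity, boundedness or finite range. -/
structure IsTransitionFunction {S : Type*} (a : S → S → ℝ) (p : ℝ≥0 → S → S → ℝ) : Prop where
  rate_nonneg : ∀ i j, 0 ≤ a i j
  rate_summable : ∀ i, Summable (a i)
  nonneg : ∀ t i j, 0 ≤ p t i j
  hasSum_one : ∀ t i, HasSum (p t i) 1
  zero : ∀ i j, p 0 i j = Set.indicator {i} (fun _ => (1 : ℝ)) j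
  chapman_kolmogorov : ∀ s t i k, HasSum (fun j => p s i j * p t j k) (p (s + t) i k)
  hasDerivWithinAt_zero : ∀ i j,
    HasDerivWithinAt (fun t : ℝ => p t.toNNReal i j) (rateMatrix a i j) (Set.Ici 0) 0

/-- `X` is, under the probability measure `P`, a (jointly measurable) time-homogeneous Markov
process with transition rates `a` and transition probabilities `p`, started in `i`. The Markov
property is expressed by the finite-dimensional distributions:
`P(X_{t_0} = j_0, …, X_{t_n} = j_n) = 1_{j_0 = i} ∏ p_{t_{k+1} - t_k}(j_k, j_{k+1})`
for all `0 = t_0 ≤ t_1 ≤ … ≤ t_n`. -/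
structure IsMarkovProcess {S Ω : Type*} [MeasurableSpace S] [MeasurableSpace Ω]
    (a : S → S → ℝ) (p : ℝ≥0 → S → S → ℝ) (i : S) (P : Measure Ω)
    (X : ℝ≥0 → Ω → S) : Prop where
  isTransitionFunction : IsTransitionFunction a p
  measurable : Measurable (fun z : ℝ≥0 × Ω => X z.1 z.2)
  finiteDim : ∀ (n : ℕ) (t : Fin (n + 1) → ℝ≥0) (j : Fin (n + 1) → S), Monotone t → t 0 = 0 →
    P.real {ω | ∀ k, X (t k) ω = j k} =
      Set.indicator {i} (fun _ => (1 : ℝ)) (j 0) *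
        ∏ k : Fin n, p (t k.succ - t k.castSucc) (j k.castSucc) (j k.succ)

/-- The local time `L_t = ∫_0^t δ_i(X_s) ds` of `X` in the state `i`. -/
def localTime {S Ω : Type*} (X : ℝ≥0 → Ω → S) (i : S) (t : ℝ≥0) (ω : Ω) : ℝ :=
  ∫ s in (0 : ℝ)..(t : ℝ), Set.indicator {i} (fun _ => (1 : ℝ)) (X s.toNNReal ω)

/-- The Green function `G_∞(i, j) = ∫_0^∞ p_t(i, j) dt`, with values in `[0, ∞]`. -/
def greenFunction {S : Type*} (p : ℝ≥0 → S → S → ℝ) (i j : S) : ℝ≥0∞ :=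
  ∫⁻ t in Set.Ioi (0 : ℝ), ENNReal.ofReal (p t.toNNReal i j)

end

/-!
The visits of `X` to `i` form a regenerative phenomenon, so every moment of the time spent in `i`
during `(s, s + r]`, restricted to `X_s = i`, is `p_s(i, i)` times the same moment for `(0, r]`.
Integrating `d/ds exp (κ (L_t - L_s))` therefore yields the renewal equation
`f(t) = 1 + κ ∫_0^t p_s(i, i) f(t - s) ds` for `f(t) = E[exp (κ L_t)]`, and hence
`f̂(l) = 1 / (l (1 - κ p̂(l)))` for the Laplace transforms. The asymptotics of `p_t(i, i)` determine
those of `p̂` at `0` by Abelian theorems. Since `f` is decreasing for `κ < 0`, Karamata's Tauberian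
theorem turns the asymptotics of `f̂` at `0` into those of `f` at infinity.
-/

section

open Set Real ProbabilityTheory

section Moments

variable {Ω ι : Type*} [MeasurableSpace Ω] {μ : Measure Ω} {L : Filter ι}
  {h : ι → Ω → ℝ} {h₀ Y : Ω → ℝ} {a b : ℝ}

lemma integrable_comp_mul_of_mem_Icc (hY : AEMeasurable Y μ) (hmem : ∀ᵐ ω ∂μ, Y ω ∈ Icc a b)
    {φ : ℝ → ℝ} (hφ : Continuous φ) (hh₀ : Integrable h₀ μ) :
    Integrable (fun ω => φ (Y ω) * h₀ ω) μ := by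
  obtain ⟨C, hC⟩ := isCompact_Icc.exists_bound_of_continuousOn hφ.continuousOn (s := Icc a b)
  exact hh₀.bdd_mul (hφ.measurable.comp_aemeasurable hY).aestronglyMeasurable
    (hmem.mono fun ω hω => hC _ hω)

lemma tendsto_integral_eval_mul (hY : AEMeasurable Y μ) (hmem : ∀ᵐ ω ∂μ, Y ω ∈ Icc a b)
    (hh : ∀ i, Integrable (h i) μ) (hh₀ : Integrable h₀ μ)
    (hmom : ∀ n : ℕ, Tendsto (fun i => ∫ ω, Y ω ^ n * h i ω ∂μ) L (𝓝 (∫ ω, Y ω ^ n * h₀ ω ∂μ)))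
    (p : Polynomial ℝ) :
    Tendsto (fun i => ∫ ω, p.eval (Y ω) * h i ω ∂μ) L (𝓝 (∫ ω, p.eval (Y ω) * h₀ ω ∂μ)) := by
  induction p using Polynomial.induction_on' with
  | add p q hp hq =>
    have integral_add_eval {f : Ω → ℝ} (hf : Integrable f μ) :
        ∫ ω, (p + q).eval (Y ω) * f ω ∂μ
          = ∫ ω, p.eval (Y ω) * f ω ∂μ + ∫ ω, q.eval (Y ω) * f ω ∂μ := by
      simp only [Polynomial.eval_add, add_mul]
      exact integral_add (integrable_comp_mul_of_mem_Icc hY hmem p.continuous hf)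
        (integrable_comp_mul_of_mem_Icc hY hmem q.continuous hf)
    simpa only [integral_add_eval hh₀, integral_add_eval (hh _)] using hp.add hq
  | monomial n c =>
    simpa only [Polynomial.eval_monomial, mul_assoc, integral_const_mul] using (hmom n).const_mul c

theorem tendsto_integral_comp_mul_of_tendsto_integral_pow_mul
    (hY : AEMeasurable Y μ) (hmem : ∀ᵐ ω ∂μ, Y ω ∈ Icc a b)
    (hh : ∀ i, Integrable (h i) μ) (hh₀ : Integrable h₀ μ) (hnonneg : ∀ i, 0 ≤ᵐ[μ] h i)
    (hmom : ∀ n : ℕ, Tendsto (fun i => ∫ ω, Y ω ^ n * h i ω ∂μ) L (𝓝 (∫ ω, Y ω ^ n * h₀ ω ∂μ)))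
    {φ : ℝ → ℝ} (hφ : Continuous φ) :
    Tendsto (fun i => ∫ ω, φ (Y ω) * h i ω ∂μ) L (𝓝 (∫ ω, φ (Y ω) * h₀ ω ∂μ)) := by
  rw [Metric.tendsto_nhds]
  intro ε hε
  set C := ∫ ω, h₀ ω ∂μ + 1 + ∫ ω, |h₀ ω| ∂μ with hC
  have hC_pos : 0 < C := by
    linarith [(abs_integral_le_integral_abs (f := h₀) (μ := μ)), neg_abs_le (∫ ω, h₀ ω ∂μ)]
  obtain ⟨p, hp⟩ := exists_polynomial_near_of_continuousOn a b φ hφ.continuousOn (ε / 2 / C)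
    (by positivity)
  have approx {f : Ω → ℝ} (hf : Integrable f μ) :
      dist (∫ ω, φ (Y ω) * f ω ∂μ) (∫ ω, p.eval (Y ω) * f ω ∂μ) ≤ ε / 2 / C * ∫ ω, |f ω| ∂μ := by
    rw [dist_eq_norm, ← integral_sub (integrable_comp_mul_of_mem_Icc hY hmem hφ hf)
      (integrable_comp_mul_of_mem_Icc hY hmem p.continuous hf), ← integral_const_mul]
    refine norm_integral_le_of_norm_le (hf.abs.const_mul _) (hmem.mono fun ω hω => ?_)
    rw [← sub_mul, norm_mul, Real.norm_eq_abs, Real.norm_eq_abs, abs_sub_comm]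
    exact mul_le_mul_of_nonneg_right (hp _ hω).le (abs_nonneg _)
  have mass : ∀ᶠ i in L, ∫ ω, |h i ω| ∂μ < ∫ ω, h₀ ω ∂μ + 1 := by
    have := (hmom 0).eventually (gt_mem_nhds (lt_add_one _))
    simp only [pow_zero, one_mul] at this
    refine this.mono fun i hi => hi.trans_eq' (integral_congr_ae ?_)
    exact (hnonneg i).mono fun ω hω => (abs_of_nonneg hω).symm
  have poly := (Metric.tendsto_nhds.1 (tendsto_integral_eval_mul hY hmem hh hh₀ hmom p))
    (ε / 2) (by positivity)
  filter_upwards [mass, poly] with i hi hpi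
  calc dist (∫ ω, φ (Y ω) * h i ω ∂μ) (∫ ω, φ (Y ω) * h₀ ω ∂μ)
      ≤ ε / 2 / C * ∫ ω, |h i ω| ∂μ
        + dist (∫ ω, p.eval (Y ω) * h i ω ∂μ) (∫ ω, p.eval (Y ω) * h₀ ω ∂μ)
        + ε / 2 / C * ∫ ω, |h₀ ω| ∂μ := by
        refine (dist_triangle4 _ _ _ _).trans
          (add_le_add (add_le_add_left (approx (hh i)) _) ((dist_comm _ _).trans_le (approx hh₀)))
    _ < ε / 2 / C * (∫ ω, h₀ ω ∂μ + 1) + ε / 2 + ε / 2 / C * ∫ ω, |h₀ ω| ∂μ := by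
        gcongr
    _ = ε := by
        rw [add_right_comm, ← mul_add, ← hC, div_mul_cancel₀ _ hC_pos.ne', add_halves]

lemma eventually_exists_lt_of_tendsto_integral_mul {w : Ω → ℝ} {s : Set Ω} {c : ℝ}
    (hs : μ s ≠ 0) (hw : Integrable w μ) (hw_pos : ∀ ω ∈ s, 0 < w ω) (hw_zero : ∀ ω ∉ s, w ω = 0)
    (hh : ∀ i, Integrable (fun ω => w ω * h i ω) μ) (hh₀ : Integrable (fun ω => w ω * h₀ ω) μ)
    (hlim : Tendsto (fun i => ∫ ω, w ω * h i ω ∂μ) L (𝓝 (∫ ω, w ω * h₀ ω ∂μ)))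
    (hc : ∀ ω ∈ s, h₀ ω < c) :
    ∀ᶠ i in L, ∃ ω ∈ s, h i ω < c := by
  have gap : 0 < ∫ ω, (w ω * c - w ω * h₀ ω) ∂μ := by
    have hpos : ∀ ω ∈ s, 0 < w ω * c - w ω * h₀ ω := fun ω hω =>
      sub_pos.2 (mul_lt_mul_of_pos_left (hc ω hω) (hw_pos ω hω))
    refine (integral_pos_iff_support_of_nonneg ?_ ((hw.mul_const c).sub hh₀)).2 ?_
    rotate_left
    · exact (pos_iff_ne_zero.2 hs).trans_le (measure_mono fun ω hω => (hpos ω hω).ne')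
    · intro ω
      by_cases hω : ω ∈ s
      · exact (hpos ω hω).le
      · simp [hw_zero ω hω]
  rw [integral_sub (hw.mul_const c) hh₀, sub_pos] at gap
  filter_upwards [hlim.eventually (gt_mem_nhds gap)] with i hi
  by_contra! hge
  refine hi.not_ge (integral_mono (hw.mul_const c) (hh i) fun ω => ?_)
  by_cases hω : ω ∈ s
  · exact mul_le_mul_of_nonneg_left (hge ω hω) (hw_pos ω hω).le
  · simp [hw_zero ω hω]

end Moments

section LaplaceTransform

/-- The Laplace transform `l ↦ ∫_0^∞ e^{-l t} f(t) dt` of a function on the half-line. The values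
of `f` on `(-∞, 0]` are ignored. -/
noncomputable def laplaceTransform (f : ℝ → ℝ) (l : ℝ) : ℝ :=
  ∫ t in Ioi 0, exp (-(l * t)) * f t

variable {f g : ℝ → ℝ} {l : ℝ}

lemma integrableOn_exp_neg_mul_Ioi (hl : 0 < l) :
    IntegrableOn (fun t => exp (-(l * t))) (Ioi 0) := by
  simpa only [neg_mul] using exp_neg_integrableOn_Ioi 0 hl

lemma integrableOn_exp_neg_mul_mul_of_bound (hl : 0 < l)
    (hf : AEStronglyMeasurable f (volume.restrict (Ioi 0))) {C : ℝ} (hC : ∀ t ∈ Ioi 0, |f t| ≤ C) :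
    IntegrableOn (fun t => exp (-(l * t)) * f t) (Ioi 0) :=
  (integrableOn_exp_neg_mul_Ioi hl).mul_bdd hf
    ((ae_restrict_mem measurableSet_Ioi).mono hC)

lemma integrableOn_exp_neg_mul_rpow (hl : 0 < l) {s : ℝ} (hs : -1 < s) :
    IntegrableOn (fun t => exp (-(l * t)) * t ^ s) (Ioi 0) := by
  simpa only [rpow_one, neg_mul, mul_comm (exp _)] using
    integrableOn_rpow_mul_exp_neg_mul_rpow hs one_pos hl

lemma laplaceTransform_const (hl : 0 < l) (c : ℝ) : laplaceTransform (fun _ => c) l = c / l := by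
  have := integral_exp_mul_Ioi (neg_lt_zero.2 hl) 0
  simp only [neg_mul, mul_zero, exp_zero] at this
  rw [laplaceTransform, integral_mul_const, this]
  field_simp

lemma laplaceTransform_rpow (hl : 0 < l) {s : ℝ} (hs : -1 < s) :
    laplaceTransform (fun t => t ^ s) l = Gamma (1 + s) * l⁻¹ ^ (1 + s) := by
  have := integral_rpow_mul_exp_neg_mul_Ioi (a := 1 + s) (by linarith) hl
  simpa only [laplaceTransform, add_sub_cancel_left, one_div, mul_comm] using this

lemma laplaceTransform_const_mul (c : ℝ) (f : ℝ → ℝ) (l : ℝ) :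
    laplaceTransform (fun t => c * f t) l = c * laplaceTransform f l := by
  simp only [laplaceTransform, mul_left_comm _ c, integral_const_mul]

lemma laplaceTransform_mul_const (c : ℝ) (f : ℝ → ℝ) (l : ℝ) :
    laplaceTransform (fun t => f t * c) l = laplaceTransform f l * c := by
  simp only [mul_comm _ c, laplaceTransform_const_mul]

lemma laplaceTransform_comp_mul (f : ℝ → ℝ) (l : ℝ) {m : ℝ} (hm : 0 < m) :
    laplaceTransform (fun t => f (m * t)) l = m⁻¹ * laplaceTransform f (l / m) := by
  have := integral_comp_mul_left_Ioi (fun t => exp (-(l / m * t)) * f t) 0 hm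
  rw [mul_zero, smul_eq_mul] at this
  rw [laplaceTransform, laplaceTransform, ← this]
  refine integral_congr_ae (.of_forall fun t => ?_)
  field_simp

lemma integrableOn_exp_neg_mul_comp_mul {m : ℝ} (hm : 0 < m)
    (hf : IntegrableOn (fun t => exp (-(l / m * t)) * f t) (Ioi 0)) :
    IntegrableOn (fun t => exp (-(l * t)) * f (m * t)) (Ioi 0) := by
  have := (integrableOn_Ioi_comp_mul_left_iff (fun t => exp (-(l / m * t)) * f t) 0 hm).2
    (by rwa [mul_zero])
  refine this.congr_fun (fun t _ => ?_) measurableSet_Ioi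
  field_simp

variable {ι : Type*} {L : Filter ι} {F : ι → ℝ → ℝ} {x : ℝ}

lemma ae_exp_neg_mem_Icc : ∀ᵐ t ∂volume.restrict (Ioi (0 : ℝ)), exp (-t) ∈ Icc (0 : ℝ) 1 := by
  filter_upwards [ae_restrict_mem measurableSet_Ioi] with t ht
  exact ⟨(exp_pos _).le, exp_le_one_iff.2 (neg_nonpos.2 (mem_Ioi.1 ht).le)⟩

lemma tendsto_integral_comp_exp_neg_mul_of_tendsto_laplaceTransform
    (hF_nonneg : ∀ i, ∀ t ∈ Ioi 0, 0 ≤ F i t)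
    (hF : ∀ i, IntegrableOn (fun t => exp (-t) * F i t) (Ioi 0))
    (hg : IntegrableOn (fun t => exp (-t) * g t) (Ioi 0))
    (hlim : ∀ n : ℕ, Tendsto (fun i => laplaceTransform (F i) (n + 1)) L
      (𝓝 (laplaceTransform g (n + 1))))
    {φ : ℝ → ℝ} (hφ : Continuous φ) :
    Tendsto (fun i => ∫ t in Ioi 0, φ (exp (-t)) * (exp (-t) * F i t)) L
      (𝓝 (∫ t in Ioi 0, φ (exp (-t)) * (exp (-t) * g t))) := by
  refine tendsto_integral_comp_mul_of_tendsto_integral_pow_mul (by fun_prop) ae_exp_neg_mem_Icc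
    hF hg ?_ ?_ hφ
  · intro i
    filter_upwards [ae_restrict_mem measurableSet_Ioi] with t ht
    exact mul_nonneg (exp_pos _).le (hF_nonneg i t ht)
  · intro n
    have moment_eq (h : ℝ → ℝ) :
        laplaceTransform h (n + 1) = ∫ t in Ioi 0, exp (-t) ^ n * (exp (-t) * h t) := by
      have exp_eq (t : ℝ) : exp (-((n + 1) * t)) = exp (-t) ^ n * exp (-t) := by
        rw [← exp_nat_mul, ← exp_add]
        ring_nf
      simp only [laplaceTransform, exp_eq, mul_assoc]
    simpa only [moment_eq] using hlim n

lemma eventually_exists_lt_of_tendsto_integral_comp_exp_neg_mul {u v c : ℝ} (hu : 0 ≤ u)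
    (huv : u < v)
    (hF : ∀ i, IntegrableOn (fun t => exp (-t) * F i t) (Ioi 0))
    (hg : IntegrableOn (fun t => exp (-t) * g t) (Ioi 0))
    (hlim : ∀ φ : ℝ → ℝ, Continuous φ →
      Tendsto (fun i => ∫ t in Ioi 0, φ (exp (-t)) * (exp (-t) * F i t)) L
        (𝓝 (∫ t in Ioi 0, φ (exp (-t)) * (exp (-t) * g t))))
    (hc : ∀ t ∈ Ioo u v, g t < c) :
    ∀ᶠ i in L, ∃ t ∈ Ioo u v, F i t < c := by
  set s := (Ioo (exp (-v)) (exp (-u)))ᶜ with hs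
  have mem_s (t : ℝ) : exp (-t) ∈ s ↔ t ∉ Ioo u v := by
    simp only [hs, mem_compl_iff, mem_Ioo, exp_lt_exp, neg_lt_neg_iff, and_comm]
  have s_closed : IsClosed s := isOpen_Ioo.isClosed_compl
  have s_nonempty : s.Nonempty := ⟨exp (-v), fun h => h.1.false⟩
  have dist_cont : Continuous fun y => Metric.infDist y s := Metric.continuous_infDist_pt s
  have integrable {h : ℝ → ℝ} (hh : IntegrableOn (fun t => exp (-t) * h t) (Ioi 0)) :
      IntegrableOn (fun t => Metric.infDist (exp (-t)) s * exp (-t) * h t) (Ioi 0) := by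
    simp only [mul_assoc]
    exact integrable_comp_mul_of_mem_Icc (by fun_prop) ae_exp_neg_mem_Icc dist_cont hh
  refine eventually_exists_lt_of_tendsto_integral_mul (μ := volume.restrict (Ioi 0))
    (w := fun t => Metric.infDist (exp (-t)) s * exp (-t)) (h₀ := g) ?_ ?_ ?_ ?_
    (fun i => integrable (hF i)) (integrable hg) ?_ hc
  · rw [Measure.restrict_apply measurableSet_Ioo,
      inter_eq_self_of_subset_left (Ioo_subset_Ioi_self.trans (Ioi_subset_Ioi hu))]
    simpa using huv
  · simpa only [mul_one, IntegrableOn] using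
      integrable (h := fun _ => 1) (by simpa using integrableOn_exp_neg_Ioi 0)
  · exact fun t ht => mul_pos ((s_closed.notMem_iff_infDist_pos s_nonempty).1
      fun h => (mem_s t).1 h ht) (exp_pos _)
  · exact fun t ht => by rw [Metric.infDist_zero_of_mem ((mem_s t).2 ht), zero_mul]
  · simpa only [mul_assoc] using hlim _ dist_cont

/-- Antitone functions are recovered from their local averages, so pointwise convergence follows
from convergence of the moments of the images of `e^{-t} F_i(t) dt` under `t ↦ e^{-t}`. -/
theorem tendsto_of_tendsto_laplaceTransform
    (hF_anti : ∀ i, AntitoneOn (F i) (Ioi 0)) (hF_nonneg : ∀ i, ∀ t ∈ Ioi 0, 0 ≤ F i t)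
    (hF : ∀ i, IntegrableOn (fun t => exp (-t) * F i t) (Ioi 0))
    (hg : IntegrableOn (fun t => exp (-t) * g t) (Ioi 0))
    (hlim : ∀ n : ℕ, Tendsto (fun i => laplaceTransform (F i) (n + 1)) L
      (𝓝 (laplaceTransform g (n + 1))))
    (hx : 0 < x) (hgx : ContinuousAt g x) :
    Tendsto (fun i => F i x) L (𝓝 (g x)) := by
  have weak (φ : ℝ → ℝ) (hφ : Continuous φ) :=
    tendsto_integral_comp_exp_neg_mul_of_tendsto_laplaceTransform hF_nonneg hF hg hlim hφ
  refine tendsto_order.2 ⟨fun c hc => ?_, fun c hc => ?_⟩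
  · obtain ⟨v, hxv, hv⟩ := exists_Ico_subset_of_mem_nhds
      (hgx.eventually (lt_mem_nhds hc)) (exists_gt x)
    have weak_neg : ∀ φ : ℝ → ℝ, Continuous φ →
        Tendsto (fun i => ∫ t in Ioi 0, φ (exp (-t)) * (exp (-t) * -F i t)) L
          (𝓝 (∫ t in Ioi 0, φ (exp (-t)) * (exp (-t) * -g t))) := by
      simpa only [mul_neg, integral_neg] using fun φ hφ => (weak φ hφ).neg
    filter_upwards [eventually_exists_lt_of_tendsto_integral_comp_exp_neg_mul hx.le hxv
      (fun i => by simp only [mul_neg]; exact (hF i).neg) (by simp only [mul_neg]; exact hg.neg)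
      weak_neg fun t ht => neg_lt_neg (hv ⟨ht.1.le, ht.2⟩)] with i ⟨t, ht, hit⟩
    exact (neg_lt_neg_iff.1 hit).trans_le (hF_anti i hx (hx.trans ht.1) ht.1.le)
  · obtain ⟨u, ⟨hu, hux⟩, huc⟩ := exists_Ioc_subset_of_mem_nhds'
      (hgx.eventually (gt_mem_nhds hc)) hx
    filter_upwards [eventually_exists_lt_of_tendsto_integral_comp_exp_neg_mul hu hux hF hg
      weak fun t ht => huc ⟨ht.1, ht.2.le⟩] with i ⟨t, ht, hit⟩
    exact (hF_anti i (hu.trans_lt ht.1) hx ht.2.le).trans_lt hit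

end LaplaceTransform

section Convolution

variable {f g : ℝ → ℝ} {l : ℝ}

lemma exp_neg_mul_mul_integral_mul_sub (f g : ℝ → ℝ) (l t : ℝ) :
    exp (-(l * t)) * ∫ s in (0 : ℝ)..t, f s * g (t - s) =
      ∫ s in (0 : ℝ)..t, ContinuousLinearMap.mul ℝ ℝ (exp (-(l * s)) * f s)
        (exp (-(l * (t - s))) * g (t - s)) := by
  rw [← intervalIntegral.integral_const_mul]
  congr with s
  rw [ContinuousLinearMap.mul_apply', show -(l * t) = -(l * s) + -(l * (t - s)) by ring, exp_add]
  ring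

lemma integrableOn_exp_neg_mul_convolution
    (hf : IntegrableOn (fun t => exp (-(l * t)) * f t) (Ioi 0))
    (hg : IntegrableOn (fun t => exp (-(l * t)) * g t) (Ioi 0)) :
    IntegrableOn (fun t => exp (-(l * t)) * ∫ s in (0 : ℝ)..t, f s * g (t - s)) (Ioi 0) := by
  simp only [exp_neg_mul_mul_integral_mul_sub]
  exact (integrable_indicator_iff measurableSet_Ioi).1
    (integrable_posConvolution hf hg (ContinuousLinearMap.mul ℝ ℝ))

lemma laplaceTransform_convolution
    (hf : IntegrableOn (fun t => exp (-(l * t)) * f t) (Ioi 0))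
    (hg : IntegrableOn (fun t => exp (-(l * t)) * g t) (Ioi 0)) :
    laplaceTransform (fun t => ∫ s in (0 : ℝ)..t, f s * g (t - s)) l =
      laplaceTransform f l * laplaceTransform g l := by
  simp only [laplaceTransform, exp_neg_mul_mul_integral_mul_sub]
  exact integral_posConvolution hf hg (ContinuousLinearMap.mul ℝ ℝ)

lemma laplaceTransform_eq_of_renewal {κ : ℝ} (hl : 0 < l)
    (hf : IntegrableOn (fun t => exp (-(l * t)) * f t) (Ioi 0))
    (hg : IntegrableOn (fun t => exp (-(l * t)) * g t) (Ioi 0))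
    (h : ∀ t ∈ Ioi 0, g t = 1 + κ * ∫ s in (0 : ℝ)..t, f s * g (t - s)) :
    laplaceTransform g l = 1 / l + κ * (laplaceTransform f l * laplaceTransform g l) := by
  rw [← laplaceTransform_convolution hf hg, ← laplaceTransform_const hl, laplaceTransform,
    laplaceTransform, laplaceTransform, ← integral_const_mul,
    ← integral_add ((integrableOn_exp_neg_mul_Ioi hl).mul_const 1)
      ((integrableOn_exp_neg_mul_convolution hf hg).const_mul κ)]
  refine setIntegral_congr_fun measurableSet_Ioi fun t ht => ?_
  rw [h t ht]
  ring

end Convolution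

section RegularVariation

/-- `φ` varies regularly at infinity with index `ρ`. Measurability of `φ`, which is often part of
the definition, is not required. -/
def IsRegularlyVarying (φ : ℝ → ℝ) (ρ : ℝ) : Prop :=
  ∀ m : ℝ, 0 < m → Tendsto (fun t => φ (m * t) / φ t) atTop (𝓝 (m ^ ρ))

namespace IsRegularlyVarying

variable {φ ψ : ℝ → ℝ} {ρ σ : ℝ}

lemma eventually_ne_zero (hφ : IsRegularlyVarying φ ρ) : ∀ᶠ t in atTop, φ t ≠ 0 := by
  refine ((hφ 1 one_pos).eventually_ne (one_rpow ρ ▸ one_ne_zero)).mono fun t ht h => ht ?_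
  rw [h, div_zero]

lemma congr (hφ : IsRegularlyVarying φ ρ) (hψ : ψ ~[atTop] φ) : IsRegularlyVarying ψ ρ :=
  fun m hm => ((hψ.comp_tendsto (tendsto_id.const_mul_atTop hm)).div hψ).symm.tendsto_nhds (hφ m hm)

lemma div (hφ : IsRegularlyVarying φ ρ) (hψ : IsRegularlyVarying ψ σ) :
    IsRegularlyVarying (fun t => φ t / ψ t) (ρ - σ) := by
  intro m hm
  rw [rpow_sub hm]
  refine ((hφ m hm).div (hψ m hm) (rpow_pos_of_pos hm σ).ne').congr fun t => ?_
  exact div_div_div_comm _ _ _ _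

lemma const_mul (hφ : IsRegularlyVarying φ ρ) {c : ℝ} (hc : c ≠ 0) :
    IsRegularlyVarying (fun t => c * φ t) ρ := by
  simpa only [IsRegularlyVarying, mul_div_mul_left _ _ hc] using hφ

end IsRegularlyVarying

lemma isRegularlyVarying_rpow (ρ : ℝ) : IsRegularlyVarying (fun t => t ^ ρ) ρ := by
  intro m hm
  refine tendsto_const_nhds.congr' ?_
  filter_upwards [eventually_gt_atTop 0] with t ht
  rw [mul_rpow hm.le ht.le, mul_div_cancel_right₀ _ (rpow_pos_of_pos ht ρ).ne']

lemma isRegularlyVarying_id : IsRegularlyVarying (fun t => t) 1 := by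
  simpa only [rpow_one] using isRegularlyVarying_rpow 1

lemma isRegularlyVarying_const {c : ℝ} (hc : c ≠ 0) : IsRegularlyVarying (fun _ => c) 0 := by
  simpa only [rpow_zero, mul_one] using (isRegularlyVarying_rpow 0).const_mul hc

lemma isRegularlyVarying_log : IsRegularlyVarying log 0 := by
  intro m hm
  have hlim : Tendsto (fun t => log m / log t + 1) atTop (𝓝 (m ^ (0 : ℝ))) := by
    simpa only [rpow_zero, zero_add] using
      (tendsto_log_atTop.const_div_atTop (log m)).add_const 1
  refine hlim.congr' ?_
  filter_upwards [eventually_gt_atTop 1] with t ht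
  rw [log_mul hm.ne' (one_pos.trans ht).ne', add_div, div_self (log_pos ht).ne']

end RegularVariation

section Tauberian

variable {f φ : ℝ → ℝ} {ρ : ℝ}

lemma tendsto_laplaceTransform_rescaled
    (hreg : IsRegularlyVarying (fun t => laplaceTransform f t⁻¹) ρ) {l : ℝ} (hl : 0 < l) :
    Tendsto (fun t => laplaceTransform (fun x => f (t * x) * (t / laplaceTransform f t⁻¹)) l)
      atTop (𝓝 (l⁻¹ ^ ρ)) := by
  refine (hreg l⁻¹ (inv_pos.2 hl)).congr' ?_
  filter_upwards [eventually_gt_atTop 0] with t ht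
  rw [laplaceTransform_mul_const, laplaceTransform_comp_mul f l ht, mul_inv, inv_inv,
    ← div_eq_mul_inv]
  field_simp

lemma tendsto_mul_div_laplaceTransform (hρ : 0 < ρ)
    (hf_anti : AntitoneOn f (Ioi 0)) (hf_nonneg : ∀ t ∈ Ioi 0, 0 ≤ f t)
    (hf : ∀ l > 0, IntegrableOn (fun t => exp (-(l * t)) * f t) (Ioi 0))
    (hreg : IsRegularlyVarying (fun t => laplaceTransform f t⁻¹) ρ) :
    Tendsto (fun t => f t * (t / laplaceTransform f t⁻¹)) atTop (𝓝 (Gamma ρ)⁻¹) := by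
  have scale_nonneg (t : Ioi (0 : ℝ)) : 0 ≤ t / laplaceTransform f (t : ℝ)⁻¹ :=
    div_nonneg t.2.le (setIntegral_nonneg measurableSet_Ioi fun x hx =>
      mul_nonneg (exp_pos _).le (hf_nonneg x hx))
  have mul_mem (t : Ioi (0 : ℝ)) {x : ℝ} (hx : x ∈ Ioi 0) : t * x ∈ Ioi (0 : ℝ) := mul_pos t.2 hx
  have density_laplace {l : ℝ} (hl : 0 < l) :
      laplaceTransform (fun x => x ^ (ρ - 1) * (Gamma ρ)⁻¹) l = l⁻¹ ^ ρ := by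
    rw [laplaceTransform_mul_const, laplaceTransform_rpow hl (by linarith), add_sub_cancel,
      mul_right_comm, mul_inv_cancel₀ (Gamma_pos_of_pos hρ).ne', one_mul]
  have density_int : IntegrableOn (fun x => exp (-x) * (x ^ (ρ - 1) * (Gamma ρ)⁻¹)) (Ioi 0) := by
    have := (integrableOn_exp_neg_mul_rpow one_pos (s := ρ - 1) (by linarith)).mul_const (Gamma ρ)⁻¹
    simpa only [one_mul, mul_assoc, IntegrableOn] using this
  have rescaled := tendsto_of_tendsto_laplaceTransform (L := atTop) (x := 1)
    (F := fun (t : Ioi (0 : ℝ)) x => f (t * x) * (t / laplaceTransform f (t : ℝ)⁻¹))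
    (g := fun x => x ^ (ρ - 1) * (Gamma ρ)⁻¹)
    (fun t x hx y hy hxy => mul_le_mul_of_nonneg_right
      (hf_anti (mul_mem t hx) (mul_mem t hy) (mul_le_mul_of_nonneg_left hxy t.2.le))
      (scale_nonneg t))
    (fun t x hx => mul_nonneg (hf_nonneg _ (mul_mem t hx)) (scale_nonneg t))
    (fun t => by
      have := integrableOn_exp_neg_mul_comp_mul t.2 (hf (1 / t) (one_div_pos.2 t.2))
      simpa only [one_mul, mul_assoc, IntegrableOn] using this.mul_const _)
    density_int
    (fun n => by
      rw [density_laplace (by positivity)]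
      exact tendsto_comp_val_Ioi_atTop.2 (tendsto_laplaceTransform_rescaled hreg (by positivity)))
    one_pos ((continuousAt_rpow_const _ _ (.inl one_ne_zero)).mul_const _)
  simpa only [mul_one, one_rpow, one_mul, tendsto_comp_val_Ioi_atTop
    (f := fun t => f t * (t / laplaceTransform f t⁻¹))] using rescaled

/-- **Karamata's Tauberian theorem** combined with the monotone density theorem. -/
theorem isEquivalent_of_laplaceTransform_isEquivalent (hρ : 0 < ρ)
    (hf_anti : AntitoneOn f (Ioi 0)) (hf_nonneg : ∀ t ∈ Ioi 0, 0 ≤ f t)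
    (hf : ∀ l > 0, IntegrableOn (fun t => exp (-(l * t)) * f t) (Ioi 0))
    (hφ : IsRegularlyVarying φ ρ) (h : (fun t => laplaceTransform f t⁻¹) ~[atTop] φ) :
    f ~[atTop] fun t => φ t / (t * Gamma ρ) := by
  have hreg := hφ.congr h
  have hratio : (fun t => f t * (t / laplaceTransform f t⁻¹)) ~[atTop] fun _ => (Gamma ρ)⁻¹ :=
    (isEquivalent_const_iff_tendsto (inv_ne_zero (Gamma_pos_of_pos hρ).ne')).2
      (tendsto_mul_div_laplaceTransform hρ hf_anti hf_nonneg hf hreg)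
  refine ((hratio.mul h).div (.refl (u := fun t : ℝ => t))).congr_left ?_ |>.congr_right ?_
  · filter_upwards [hreg.eventually_ne_zero, eventually_gt_atTop 0] with t hΦ ht
    rw [Pi.div_apply, Pi.mul_apply, mul_assoc, div_mul_cancel₀ _ hΦ, mul_div_cancel_right₀ _ ht.ne']
  · refine .of_forall fun t => ?_
    simp only [Pi.mul_apply, Pi.div_apply, div_eq_mul_inv, mul_inv]
    ring

end Tauberian

section Abelian

variable {q r : ℝ → ℝ}

lemma laplaceTransform_sub {f g : ℝ → ℝ} {l : ℝ}
    (hf : IntegrableOn (fun t => exp (-(l * t)) * f t) (Ioi 0))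
    (hg : IntegrableOn (fun t => exp (-(l * t)) * g t) (Ioi 0)) :
    laplaceTransform (f - g) l = laplaceTransform f l - laplaceTransform g l := by
  simp only [laplaceTransform, Pi.sub_apply, mul_sub]
  exact integral_sub hf hg

theorem laplaceTransform_isLittleO
    (hq : ∀ l > 0, IntegrableOn (fun t => exp (-(l * t)) * q t) (Ioi 0))
    (hr : ∀ l > 0, IntegrableOn (fun t => exp (-(l * t)) * r t) (Ioi 0))
    (hr_nonneg : ∀ t ∈ Ioi 0, 0 ≤ r t) (h : q =o[atTop] r)
    (hr_top : Tendsto (fun t => laplaceTransform r t⁻¹) atTop atTop) :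
    (fun t => laplaceTransform q t⁻¹) =o[atTop] fun t => laplaceTransform r t⁻¹ := by
  rw [isLittleO_iff]
  intro ε hε
  obtain ⟨T, hT⟩ := eventually_atTop.1 (isLittleO_iff.1 h (half_pos hε))
  set K := ∫ t in Ioi 0, exp T * ‖exp (-(1 * t)) * q t‖ with hK
  filter_upwards [hr_top.eventually_ge_atTop 0, hr_top.eventually_ge_atTop (K / (ε / 2)),
    eventually_gt_atTop 0] with t hr0 hrK ht
  rw [norm_of_nonneg hr0]
  have hl : 0 < t⁻¹ := inv_pos.2 ht
  have split_at_T : ∀ x ∈ Ioi (0 : ℝ), ‖exp (-(t⁻¹ * x)) * q x‖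
      ≤ exp T * ‖exp (-(1 * x)) * q x‖ + ε / 2 * (exp (-(t⁻¹ * x)) * r x) := by
    intro x hx
    have hexp_le : exp (-(t⁻¹ * x)) ≤ 1 :=
      exp_le_one_iff.2 (neg_nonpos.2 (mul_nonneg hl.le (mem_Ioi.1 hx).le))
    have hr_term : 0 ≤ exp (-(t⁻¹ * x)) * r x := mul_nonneg (exp_pos _).le (hr_nonneg x hx)
    simp only [norm_mul, norm_of_nonneg (exp_pos _).le]
    rcases le_total x T with hxT | hTx
    · have hone : 1 ≤ exp T * exp (-(1 * x)) := by
        rw [← exp_add]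
        exact one_le_exp (by linarith)
      rw [← mul_assoc]
      exact le_add_of_le_of_nonneg
        (mul_le_mul_of_nonneg_right (hexp_le.trans hone) (norm_nonneg _)) (by positivity)
    · refine le_add_of_nonneg_of_le (by positivity) ?_
      have := mul_le_mul_of_nonneg_left (hT x hTx) (exp_pos (-(t⁻¹ * x))).le
      rwa [norm_of_nonneg (hr_nonneg x hx), mul_left_comm] at this
  calc ‖laplaceTransform q t⁻¹‖
      ≤ ∫ x in Ioi 0, (exp T * ‖exp (-(1 * x)) * q x‖ + ε / 2 * (exp (-(t⁻¹ * x)) * r x)) :=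
        norm_integral_le_of_norm_le (((hq 1 one_pos).norm.const_mul _).add ((hr _ hl).const_mul _))
          ((ae_restrict_mem measurableSet_Ioi).mono split_at_T)
    _ = K + ε / 2 * laplaceTransform r t⁻¹ := by
        rw [integral_add ((hq 1 one_pos).norm.const_mul _) ((hr _ hl).const_mul _),
          integral_const_mul (ε / 2), ← hK, laplaceTransform]
    _ ≤ ε * laplaceTransform r t⁻¹ := by
        linarith [(div_le_iff₀' (half_pos hε)).1 hrK]

theorem laplaceTransform_isEquivalent
    (hq : ∀ l > 0, IntegrableOn (fun t => exp (-(l * t)) * q t) (Ioi 0))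
    (hr : ∀ l > 0, IntegrableOn (fun t => exp (-(l * t)) * r t) (Ioi 0))
    (hr_nonneg : ∀ t ∈ Ioi 0, 0 ≤ r t) (h : q ~[atTop] r)
    (hr_top : Tendsto (fun t => laplaceTransform r t⁻¹) atTop atTop) :
    (fun t => laplaceTransform q t⁻¹) ~[atTop] fun t => laplaceTransform r t⁻¹ := by
  have hsub : ∀ l > 0, IntegrableOn (fun t => exp (-(l * t)) * (q - r) t) (Ioi 0) := by
    simp only [Pi.sub_apply, mul_sub]
    exact fun l hl => (hq l hl).sub (hr l hl)
  refine (laplaceTransform_isLittleO hsub hr hr_nonneg h.isLittleO hr_top).congr' ?_ .rfl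
  filter_upwards [eventually_gt_atTop 0] with t ht
  exact laplaceTransform_sub (hq _ (inv_pos.2 ht)) (hr _ (inv_pos.2 ht))

theorem laplaceTransform_isEquivalent_rpow {c s : ℝ} (hc : 0 < c) (hs : -1 < s)
    (hq : ∀ l > 0, IntegrableOn (fun t => exp (-(l * t)) * q t) (Ioi 0))
    (h : q ~[atTop] fun t => c * t ^ s) :
    (fun t => laplaceTransform q t⁻¹) ~[atTop] fun t => c * Gamma (1 + s) * t ^ (1 + s) := by
  have hΓ : 0 < c * Gamma (1 + s) := mul_pos hc (Gamma_pos_of_pos (by linarith))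
  have transform_eq : (fun t => laplaceTransform (fun x => c * x ^ s) t⁻¹)
      =ᶠ[atTop] fun t => c * Gamma (1 + s) * t ^ (1 + s) := by
    filter_upwards [eventually_gt_atTop 0] with t ht
    rw [laplaceTransform_const_mul, laplaceTransform_rpow (inv_pos.2 ht) hs, inv_inv, mul_assoc]
  refine (laplaceTransform_isEquivalent hq ?_ ?_ h ?_).congr_right transform_eq
  · intro l hl
    simpa only [mul_left_comm _ c, IntegrableOn] using
      (integrableOn_exp_neg_mul_rpow hl hs).const_mul c
  · exact fun t ht => mul_nonneg hc.le (rpow_nonneg (mem_Ioi.1 ht).le s)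
  · exact ((tendsto_rpow_atTop (by linarith)).const_mul_atTop hΓ).congr' transform_eq.symm

lemma one_sub_exp_neg_div_mem_Icc {t : ℝ} (ht : 0 < t) : (1 - exp (-t)) / t ∈ Icc 0 1 :=
  ⟨div_nonneg (sub_nonneg.2 (exp_le_one_iff.2 (by linarith))) ht.le,
    (div_le_one ht).2 (by linarith [one_sub_le_exp_neg t])⟩

lemma integrableOn_exp_neg_mul_one_sub_exp_neg_div {l : ℝ} (hl : 0 < l) :
    IntegrableOn (fun t => exp (-(l * t)) * ((1 - exp (-t)) / t)) (Ioi 0) :=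
  integrableOn_exp_neg_mul_mul_of_bound (C := 1) hl
    (by fun_prop : Measurable fun t : ℝ => (1 - exp (-t)) / t).aestronglyMeasurable fun t ht => by
      have := one_sub_exp_neg_div_mem_Icc ht
      rw [abs_of_nonneg this.1]
      exact this.2

lemma laplaceTransform_one_sub_exp_neg_div {l : ℝ} (hl : 0 < l) :
    laplaceTransform (fun t => (1 - exp (-t)) / t) l = log ((l + 1) / l) := by
  have frullani_form : ∀ t ∈ Ioi (0 : ℝ), exp (-(l * t)) * ((1 - exp (-t)) / t)
      = t⁻¹ • (exp (-(l * t)) - exp (-((l + 1) * t))) := by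
    intro t _
    rw [smul_eq_mul, add_one_mul, neg_add, exp_add]
    ring
  have lim_zero : Tendsto (fun t => exp (-t)) (𝓝[>] 0) (𝓝 1) := by
    have : Continuous fun t => exp (-t) := by fun_prop
    simpa using (this.tendsto 0).mono_left nhdsWithin_le_nhds
  rw [laplaceTransform, setIntegral_congr_fun measurableSet_Ioi frullani_form,
    Frullani.integral_Ioi_eq (f := fun t => exp (-t))
      ((continuous_exp.comp continuous_neg).locallyIntegrable.locallyIntegrableOn _)
      hl (by linarith) lim_zero tendsto_exp_neg_atTop_nhds_zero
      ((integrableOn_exp_neg_mul_one_sub_exp_neg_div hl).congr_fun frullani_form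
        measurableSet_Ioi), sub_zero, smul_eq_mul, mul_one]

lemma log_add_one_isEquivalent : (fun t => log (t + 1)) ~[atTop] log :=
  (IsEquivalent.refl.add_isLittleO (isLittleO_const_id_atTop 1)).log tendsto_id

theorem laplaceTransform_isEquivalent_log {c : ℝ} (hc : 0 < c)
    (hq : ∀ l > 0, IntegrableOn (fun t => exp (-(l * t)) * q t) (Ioi 0))
    (h : q ~[atTop] fun t => c * t⁻¹) :
    (fun t => laplaceTransform q t⁻¹) ~[atTop] fun t => c * log t := by
  -- `t⁻¹` is not integrable at `0`, so it is replaced by `(1 - e^{-t}) / t ~ t⁻¹`.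
  have hr : q ~[atTop] fun t => c * ((1 - exp (-t)) / t) := by
    have hone : (fun t => 1 - exp (-t)) ~[atTop] fun _ => (1 : ℝ) := by
      refine (isEquivalent_const_iff_tendsto one_ne_zero).2 ?_
      simpa using tendsto_exp_neg_atTop_nhds_zero.const_sub 1
    refine h.trans (IsEquivalent.refl.mul ?_)
    simpa only [Pi.mul_def, one_mul, div_eq_mul_inv] using (hone.mul (.refl (u := Inv.inv))).symm
  have transform_eq : (fun t => laplaceTransform (fun x => c * ((1 - exp (-x)) / x)) t⁻¹)
      =ᶠ[atTop] fun t => c * log (t + 1) := by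
    filter_upwards [eventually_gt_atTop 0] with t ht
    rw [laplaceTransform_const_mul, laplaceTransform_one_sub_exp_neg_div (inv_pos.2 ht),
      div_inv_eq_mul, add_mul, inv_mul_cancel₀ ht.ne', one_mul, add_comm]
  refine ((laplaceTransform_isEquivalent hq ?_ ?_ hr ?_).congr_right transform_eq).trans
    (IsEquivalent.refl.mul log_add_one_isEquivalent)
  · intro l hl
    simpa only [mul_left_comm _ c, IntegrableOn] using
      (integrableOn_exp_neg_mul_one_sub_exp_neg_div hl).const_mul c
  · exact fun t ht => mul_nonneg hc.le (one_sub_exp_neg_div_mem_Icc ht).1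
  · exact ((tendsto_log_atTop.comp (tendsto_atTop_add_const_right _ 1 tendsto_id)).const_mul_atTop
      hc).congr' transform_eq.symm

lemma integrableOn_Ioi_of_isEquivalent_rpow {c s : ℝ} (hs : s < -1)
    (hq : ∀ l > 0, IntegrableOn (fun t => exp (-(l * t)) * q t) (Ioi 0))
    (h : q ~[atTop] fun t => c * t ^ s) : IntegrableOn q (Ioi 0) := by
  have hloc : LocallyIntegrableOn q (Ici 0) := by
    have := (((integrableOn_Ici_iff_integrableOn_Ioi).2 (hq 1 one_pos)).locallyIntegrableOn
      ).continuousOn_mul continuous_exp.continuousOn isClosed_Ici.isLocallyClosed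
    simpa only [← mul_assoc, ← exp_add, one_mul, add_neg_cancel, exp_zero] using this
  exact (hloc.integrableOn_of_isBigO_atTop (h.isBigO.trans (isBigO_const_mul_self c _ _))
    (integrableAtFilter_rpow_atTop_iff.2 hs)).mono_set Ioi_subset_Ici_self

lemma tendsto_laplaceTransform_inv_atTop (hq : IntegrableOn q (Ioi 0)) :
    Tendsto (fun t => laplaceTransform q t⁻¹) atTop (𝓝 (∫ t in Ioi 0, q t)) := by
  refine tendsto_integral_filter_of_dominated_convergence (fun x => ‖q x‖) ?_ ?_ hq.norm ?_
  · exact .of_forall fun t =>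
      (by fun_prop : Continuous fun x => exp (-(t⁻¹ * x))).aestronglyMeasurable.mul hq.1
  · filter_upwards [eventually_gt_atTop 0] with t ht
    filter_upwards [ae_restrict_mem measurableSet_Ioi] with x hx
    rw [norm_mul, norm_of_nonneg (exp_pos _).le]
    exact mul_le_of_le_one_left (norm_nonneg _)
      (exp_le_one_iff.2 (neg_nonpos.2 (mul_nonneg (inv_pos.2 ht).le (mem_Ioi.1 hx).le)))
  · refine .of_forall fun x => ?_
    have : Tendsto (fun t : ℝ => exp (-(t⁻¹ * x)) * q x) atTop (𝓝 (exp (-(0 * x)) * q x)) :=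
      ((continuous_exp.tendsto _).comp (tendsto_inv_atTop_zero.mul_const x).neg).mul_const _
    simpa only [zero_mul, neg_zero, exp_zero, one_mul] using this

end Abelian

section ExponentialIntegral

lemma absolutelyContinuousOnInterval_comp_of_lipschitzOnWith {f φ : ℝ → ℝ} {a b : ℝ} {s : Set ℝ}
    {K : ℝ≥0} (hφ : LipschitzOnWith K φ s) (hf : AbsolutelyContinuousOnInterval f a b)
    (hfs : MapsTo f (uIcc a b) s) : AbsolutelyContinuousOnInterval (φ ∘ f) a b := by
  rw [absolutelyContinuousOnInterval_iff] at hf ⊢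
  intro ε hε
  obtain ⟨δ, hδ, hfδ⟩ := hf (ε / (K + 1)) (by positivity)
  refine ⟨δ, hδ, fun E hE hEδ => ?_⟩
  calc ∑ i ∈ Finset.range E.1, dist (φ (f (E.2 i).1)) (φ (f (E.2 i).2))
      ≤ ∑ i ∈ Finset.range E.1, (K + 1) * dist (f (E.2 i).1) (f (E.2 i).2) := by
        refine Finset.sum_le_sum fun i hi => ?_
        refine (hφ.dist_le_mul _ (hfs (hE.1 i hi).1) _ (hfs (hE.1 i hi).2)).trans ?_
        gcongr
        linarith
    _ = (K + 1) * ∑ i ∈ Finset.range E.1, dist (f (E.2 i).1) (f (E.2 i).2) :=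
        (Finset.mul_sum _ _ _).symm
    _ < (K + 1) * (ε / (K + 1)) := by
        gcongr
        exact hfδ E hE hEδ
    _ = ε := mul_div_cancel₀ ε (by positivity)

lemma exists_lipschitzOnWith_exp_Iic (C : ℝ) : ∃ K, LipschitzOnWith K exp (Iic C) := by
  refine ⟨(exp C).toNNReal, (convex_Iic C).lipschitzOnWith_of_nnnorm_deriv_le
    (fun x _ => differentiableAt_exp) fun x hx => ?_⟩
  rw [Real.deriv_exp, ← NNReal.coe_le_coe, coe_nnnorm, norm_of_nonneg (exp_pos x).le,
    coe_toNNReal _ (exp_pos C).le]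
  exact exp_le_exp.2 hx

lemma absolutelyContinuousOnInterval_exp_comp {f : ℝ → ℝ} {a b : ℝ}
    (hf : AbsolutelyContinuousOnInterval f a b) :
    AbsolutelyContinuousOnInterval (exp ∘ f) a b := by
  obtain ⟨C, hC⟩ := hf.exists_bound
  obtain ⟨K, hK⟩ := exists_lipschitzOnWith_exp_Iic C
  exact absolutelyContinuousOnInterval_comp_of_lipschitzOnWith hK hf
    fun s hs => (le_norm_self _).trans (hC s hs)

theorem integral_mul_exp_integral_eq_sub_one {g : ℝ → ℝ} {a b : ℝ}
    (hg : IntervalIntegrable g volume a b) :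
    ∫ s in a..b, g s * exp (∫ u in s..b, g u) = exp (∫ u in a..b, g u) - 1 := by
  have neg_integral (s : ℝ) : -∫ u in b..s, g u = ∫ u in s..b, g u :=
    (intervalIntegral.integral_symm b s).symm
  have exp_ac : AbsolutelyContinuousOnInterval (fun s => exp (-∫ u in b..s, g u)) a b :=
    absolutelyContinuousOnInterval_exp_comp
      (hg.absolutelyContinuousOnInterval_intervalIntegral right_mem_uIcc).neg
  have deriv_eq : ∀ᵐ s, s ∈ uIoc a b → deriv (fun s => exp (-∫ u in b..s, g u)) s
      = -(g s * exp (-∫ u in b..s, g u)) := by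
    filter_upwards [hg.ae_hasDerivAt_integral] with s hs hsab
    have := (hs (uIoc_subset_uIcc hsab) b right_mem_uIcc).neg.exp.deriv
    simp only [Pi.neg_apply] at this
    rw [this]
    ring
  have ftc := exp_ac.integral_deriv_eq_sub
  rw [intervalIntegral.integral_congr_ae deriv_eq, intervalIntegral.integral_neg,
    intervalIntegral.integral_same, neg_zero, exp_zero] at ftc
  simp only [neg_integral] at ftc
  linarith

end ExponentialIntegral

section MomentGeneratingFunction

variable {Ω : Type*} [MeasurableSpace Ω] {μ : Measure Ω} [IsFiniteMeasure μ] {X : Ω → ℝ} {C : ℝ}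

theorem hasSum_mgf_of_bound (hX : AEMeasurable X μ) (hC : ∀ᵐ ω ∂μ, |X ω| ≤ C) (κ : ℝ) :
    HasSum (fun n : ℕ => κ ^ n / n.factorial * ∫ ω, X ω ^ n ∂μ) (mgf X μ κ) := by
  simp_rw [← integral_const_mul, mgf]
  refine hasSum_integral_of_dominated_convergence (fun n _ => (|κ| * C) ^ n / n.factorial)
    (fun n => ((hX.pow_const n).const_mul _).aestronglyMeasurable) (fun n => ?_)
    (.of_forall fun _ => summable_pow_div_factorial _) (integrable_const _) (.of_forall fun ω => ?_)
  · filter_upwards [hC] with ω hω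
    rw [norm_mul, norm_div, norm_pow, norm_pow, norm_natCast, norm_eq_abs, norm_eq_abs, mul_pow,
      div_mul_eq_mul_div]
    gcongr
  · simpa only [exp_eq_exp_ℝ, mul_pow, div_mul_eq_mul_div] using
      NormedSpace.expSeries_div_hasSum_exp (κ * X ω)

end MomentGeneratingFunction

section OccupationTime

variable {Ω : Type*} {E : ℝ → Set Ω} {κ s t : ℝ}

/-- The Lebesgue measure of the set of times `u ∈ (s, t]` at which the event `E u` occurs, with the
sign convention of interval integrals when `t < s`. -/
noncomputable def occupationTime (E : ℝ → Set Ω) (s t : ℝ) (ω : Ω) : ℝ :=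
  ∫ u in s..t, (E u).indicator (fun _ => (1 : ℝ)) ω

lemma occupationTime_mem_Icc (E : ℝ → Set Ω) (hst : s ≤ t) (ω : Ω) :
    occupationTime E s t ω ∈ Icc 0 (t - s) := by
  refine ⟨intervalIntegral.integral_nonneg hst
    fun u _ => indicator_nonneg (fun _ _ => one_pos.le) ω, (le_abs_self _).trans ?_⟩
  have := intervalIntegral.norm_integral_le_of_norm_le_const (a := s) (b := t)
    (f := fun u => (E u).indicator (fun _ => (1 : ℝ)) ω) (C := 1)
    fun u _ => (norm_indicator_le_norm_self _ _).trans norm_one.le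
  rwa [one_mul, abs_of_nonneg (sub_nonneg.2 hst)] at this

lemma abs_occupationTime_le (E : ℝ → Set Ω) (hst : s ≤ t) (ω : Ω) :
    |occupationTime E s t ω| ≤ t - s := by
  obtain ⟨nonneg, le⟩ := occupationTime_mem_Icc E hst ω
  rwa [abs_of_nonneg nonneg]

variable [MeasurableSpace Ω]

lemma measurableSet_section (hE : MeasurableSet {z : ℝ × Ω | z.2 ∈ E z.1}) (t : ℝ) :
    MeasurableSet (E t) :=
  hE.preimage measurable_prodMk_left

lemma measurable_indicator_prod (hE : MeasurableSet {z : ℝ × Ω | z.2 ∈ E z.1}) :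
    Measurable fun z : ℝ × Ω => (E z.1).indicator (fun _ => (1 : ℝ)) z.2 :=
  measurable_const.indicator hE

lemma intervalIntegrable_indicator (hE : MeasurableSet {z : ℝ × Ω | z.2 ∈ E z.1}) (ω : Ω)
    (s t : ℝ) :
    IntervalIntegrable (fun u => (E u).indicator (fun _ => (1 : ℝ)) ω) volume s t :=
  (intervalIntegrable_const (c := (1 : ℝ))).mono_fun
    ((measurable_indicator_prod hE).comp measurable_prodMk_right).aestronglyMeasurable
    (.of_forall fun _ => norm_indicator_le_norm_self _ _)

lemma measurable_occupationTime (hE : MeasurableSet {z : ℝ × Ω | z.2 ∈ E z.1}) (s t : ℝ) :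
    Measurable (occupationTime E s t) :=
  have hmeas := ((measurable_indicator_prod hE).comp measurable_swap).stronglyMeasurable
  (hmeas.integral_prod_right'.sub hmeas.integral_prod_right').measurable

lemma measurable_occupationTime_prod (hE : MeasurableSet {z : ℝ × Ω | z.2 ∈ E z.1}) (t : ℝ) :
    Measurable fun z : ℝ × Ω => occupationTime E z.1 t z.2 := by
  refine (stronglyMeasurable_uncurry_of_continuous_of_stronglyMeasurable (fun ω => ?_)
    fun s => (measurable_occupationTime hE s t).stronglyMeasurable).measurable
  exact (intervalIntegral.continuous_primitive (intervalIntegrable_indicator hE ω) t).neg.congr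
    fun s => (intervalIntegral.integral_symm t s).symm

lemma occupationTime_mono (hE : MeasurableSet {z : ℝ × Ω | z.2 ∈ E z.1}) {t' : ℝ} (hst : s ≤ t)
    (ht : t ≤ t') (ω : Ω) : occupationTime E s t ω ≤ occupationTime E s t' ω :=
  intervalIntegral.integral_mono_interval le_rfl hst ht
    (.of_forall fun _ => indicator_nonneg (fun _ _ => one_pos.le) ω)
    (intervalIntegrable_indicator hE ω s t')

theorem integral_occupationTime_pow (hE : MeasurableSet {z : ℝ × Ω | z.2 ∈ E z.1}) (μ : Measure Ω)
    [IsFiniteMeasure μ] (s : ℝ) {r : ℝ} (hr : 0 ≤ r) (n : ℕ) :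
    ∫ ω, occupationTime E s (s + r) ω ^ n ∂μ =
      ∫ u : Fin n → ℝ, μ.real (⋂ k, E (s + u k))
        ∂Measure.pi fun _ => volume.restrict (Ioc 0 r) := by
  have pow_eq (ω : Ω) : occupationTime E s (s + r) ω ^ n =
      ∫ u : Fin n → ℝ, (⋂ k, E (s + u k)).indicator (fun _ => (1 : ℝ)) ω
        ∂Measure.pi fun _ => volume.restrict (Ioc 0 r) := by
    have indicator_eq_prod (u : Fin n → ℝ) : (⋂ k, E (s + u k)).indicator (fun _ => (1 : ℝ)) ω =
        ∏ k, (E (s + u k)).indicator (fun _ => (1 : ℝ)) ω := by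
      simp [prod_indicator_const_apply, Pi.pow_def]
    simp only [indicator_eq_prod]
    rw [integral_fintype_prod_eq_pow (fun u => (E (s + u)).indicator (fun _ => (1 : ℝ)) ω),
      Fintype.card_fin, ← intervalIntegral.integral_of_le hr, occupationTime,
      intervalIntegral.integral_comp_add_left (fun u => (E u).indicator (fun _ => (1 : ℝ)) ω),
      add_zero]
  have meas : MeasurableSet {z : Ω × (Fin n → ℝ) | z.1 ∈ ⋂ k, E (s + z.2 k)} := by
    simp only [mem_iInter, ofPred_forall]
    exact .iInter fun k => hE.preimage (f := fun z : Ω × (Fin n → ℝ) => (s + z.2 k, z.1))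
      (by fun_prop)
  simp only [pow_eq]
  rw [integral_integral_swap]
  · refine integral_congr_ae (.of_forall fun u => ?_)
    exact integral_indicator_one (meas.preimage measurable_prodMk_right)
  · exact .of_bound (C := 1) (measurable_const.indicator meas).aestronglyMeasurable
      (.of_forall fun z => (norm_indicator_le_norm_self (fun _ => (1 : ℝ)) z.1).trans norm_one.le)

lemma exp_mul_occupationTime (hE : MeasurableSet {z : ℝ × Ω | z.2 ∈ E z.1}) (κ s t : ℝ) (ω : Ω) :
    exp (κ * occupationTime E s t ω) =
      1 + κ * ∫ u in s..t, (E u).indicator (fun ω => exp (κ * occupationTime E u t ω)) ω := by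
  have ftc := integral_mul_exp_integral_eq_sub_one
    ((intervalIntegrable_indicator hE ω s t).const_mul κ)
  simp only [intervalIntegral.integral_const_mul, mul_assoc] at ftc
  have indicator_mul (u : ℝ) : (E u).indicator (fun ω => exp (κ * occupationTime E u t ω)) ω =
      (E u).indicator (fun _ => (1 : ℝ)) ω * exp (κ * occupationTime E u t ω) := by
    by_cases hω : ω ∈ E u <;> simp [hω]
  simp only [indicator_mul]
  exact (add_eq_of_eq_sub' ftc).symm

theorem mgf_occupationTime (hE : MeasurableSet {z : ℝ × Ω | z.2 ∈ E z.1}) (μ : Measure Ω)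
    [IsFiniteMeasure μ] (κ : ℝ) (hst : s ≤ t) :
    mgf (occupationTime E s t) μ κ =
      μ.real univ + κ * ∫ u in s..t, mgf (occupationTime E u t) (μ.restrict (E u)) κ := by
  have meas : Measurable fun z : Ω × ℝ =>
      (E z.2).indicator (fun ω => exp (κ * occupationTime E z.2 t ω)) z.1 :=
    (((measurable_occupationTime_prod hE t).const_mul κ).exp.indicator hE).comp measurable_swap
  have integrable_prod : Integrable (Function.uncurry fun ω u =>
      (E u).indicator (fun ω => exp (κ * occupationTime E u t ω)) ω)
      (μ.prod (volume.restrict (Ioc s t))) := by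
    have mem_Ioc : ∀ᵐ z ∂μ.prod (volume.restrict (Ioc s t)), z.2 ∈ Ioc s t :=
      Measure.quasiMeasurePreserving_snd.ae (ae_restrict_mem measurableSet_Ioc)
    refine .of_bound (C := exp (|κ| * (t - s))) meas.aestronglyMeasurable ?_
    filter_upwards [mem_Ioc] with z hz
    refine (norm_indicator_le_norm_self (fun ω => exp (κ * occupationTime E z.2 t ω)) z.1).trans ?_
    rw [norm_eq_abs, abs_exp, exp_le_exp]
    refine (le_abs_self _).trans ((abs_mul _ _).trans_le ?_)
    gcongr
    exact (abs_occupationTime_le E hz.2 z.1).trans (sub_le_sub_left hz.1.le t)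
  have integrable_path := integrable_prod.integral_prod_left.const_mul κ
  simp only [Function.uncurry] at integrable_path
  simp only [mgf, exp_mul_occupationTime hE κ s t, intervalIntegral.integral_of_le hst]
  rw [integral_add (integrable_const 1) integrable_path, integral_const_mul,
    integral_integral_swap integrable_prod, integral_const, smul_eq_mul, mul_one]
  simp only [integral_indicator (measurableSet_section hE _)]

lemma antitoneOn_mgf_occupationTime (hE : MeasurableSet {z : ℝ × Ω | z.2 ∈ E z.1}) (μ : Measure Ω)
    [IsFiniteMeasure μ] (hκ : κ ≤ 0) (s : ℝ) :
    AntitoneOn (fun t => mgf (occupationTime E s t) μ κ) (Ici s) := fun t ht _ _ htt' =>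
  mgf_anti_of_nonpos (.of_forall (occupationTime_mono hE ht htt')) hκ
    (integrable_exp_mul_of_mem_Icc (measurable_occupationTime hE s t).aemeasurable
      (.of_forall (occupationTime_mem_Icc E ht)))

lemma mgf_occupationTime_le_measureReal_univ (E : ℝ → Set Ω) (μ : Measure Ω) [IsFiniteMeasure μ]
    (hκ : κ ≤ 0) (hst : s ≤ t) : mgf (occupationTime E s t) μ κ ≤ μ.real univ :=
  (mgf_anti_of_nonpos (.of_forall fun ω => (occupationTime_mem_Icc E hst ω).1) hκ
    (by simp)).trans_eq mgf_zero_fun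

end OccupationTime

section Regenerative

variable {Ω : Type*} [MeasurableSpace Ω]

/-- Kingman's regenerative phenomena: events `E t`, `t ≥ 0`, which occur at times
`t 0 ≤ t 1 ≤ … ≤ t n` with probability `p (t 0) * p (t 1 - t 0) * ⋯ * p (t n - t (n - 1))`, such as
the visits of a Markov process to its initial state. Only the restrictions of `p` and `E` to
`[0, ∞)` matter, apart from the joint measurability of `E`. -/
structure IsRegenerativePhenomenon (p : ℝ → ℝ) (P : Measure Ω) (E : ℝ → Set Ω) : Prop where
  measurableSet : MeasurableSet {z : ℝ × Ω | z.2 ∈ E z.1}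
  measureReal_iInter : ∀ (n : ℕ) (t : Fin (n + 1) → ℝ), 0 ≤ t 0 → Monotone t →
    P.real (⋂ k, E (t k)) = p (t 0) * ∏ k : Fin n, p (t k.succ - t k.castSucc)

namespace IsRegenerativePhenomenon

variable {p : ℝ → ℝ} {P : Measure Ω} {E : ℝ → Set Ω} (hE : IsRegenerativePhenomenon p P E)
  {κ l s t : ℝ}
include hE

lemma measureReal_eq (hs : 0 ≤ s) : P.real (E s) = p s := by
  simpa [iInter_const] using hE.measureReal_iInter 0 (fun _ => s) hs monotone_const

lemma nonneg (hs : 0 ≤ s) : 0 ≤ p s :=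
  measureReal_nonneg.trans_eq (hE.measureReal_eq hs)

lemma laplaceTransform_nonneg (l : ℝ) : 0 ≤ laplaceTransform p l :=
  setIntegral_nonneg measurableSet_Ioi fun _ ht =>
    mul_nonneg (exp_pos _).le (hE.nonneg (mem_Ioi.1 ht).le)

variable [IsProbabilityMeasure P]

lemma le_one (hs : 0 ≤ s) : p s ≤ 1 :=
  (hE.measureReal_eq hs).symm.trans_le measureReal_le_one

lemma measureReal_inter_iInter_of_monotone {n : ℕ} {u : Fin n → ℝ} (hs : 0 ≤ s)
    (hu : ∀ k, 0 ≤ u k) (hu_mono : Monotone u) :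
    P.real (E s ∩ ⋂ k, E (s + u k)) = p s * P.real (⋂ k, E (u k)) := by
  cases n with
  | zero => simp [hE.measureReal_eq hs]
  | succ n =>
    have inter_eq : E s ∩ ⋂ k, E (s + u k) = ⋂ k, E (Matrix.vecCons s (fun k => s + u k) k) := by
      ext ω
      simp [Fin.forall_fin_succ]
    rw [inter_eq, hE.measureReal_iInter _ _ hs (monotone_vecCons.2
      ⟨le_add_of_nonneg_right (hu 0), hu_mono.const_add s⟩),
      hE.measureReal_iInter n u (hu 0) hu_mono, Fin.prod_univ_succ]
    simp

lemma measureReal_inter_iInter {n : ℕ} {u : Fin n → ℝ} (hs : 0 ≤ s) (hu : ∀ k, 0 ≤ u k) :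
    P.real (E s ∩ ⋂ k, E (s + u k)) = p s * P.real (⋂ k, E (u k)) := by
  have sort_surj := (Tuple.sort u).surjective
  rw [← sort_surj.iInter_comp fun k => E (s + u k), ← sort_surj.iInter_comp fun k => E (u k)]
  exact hE.measureReal_inter_iInter_of_monotone hs (fun k => hu _) (Tuple.monotone_sort u)

lemma integral_occupationTime_pow_restrict (hs : 0 ≤ s) {r : ℝ} (hr : 0 ≤ r) (n : ℕ) :
    ∫ ω, occupationTime E s (s + r) ω ^ n ∂P.restrict (E s) =
      p s * ∫ ω, occupationTime E 0 r ω ^ n ∂P := by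
  have moment := integral_occupationTime_pow hE.measurableSet P 0 hr n
  simp only [zero_add] at moment
  rw [integral_occupationTime_pow hE.measurableSet _ _ hr, moment, ← integral_const_mul,
    ← Measure.restrict_pi_pi]
  refine setIntegral_congr_fun (.univ_pi fun _ => measurableSet_Ioc) fun u hu => ?_
  simp only [measureReal_restrict_apply' (measurableSet_section hE.measurableSet s),
    inter_comm _ (E s)]
  exact hE.measureReal_inter_iInter hs fun k => (hu k (mem_univ k)).1.le

theorem mgf_occupationTime_restrict (hs : 0 ≤ s) {r : ℝ} (hr : 0 ≤ r) (κ : ℝ) :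
    mgf (occupationTime E s (s + r)) (P.restrict (E s)) κ =
      p s * mgf (occupationTime E 0 r) P κ := by
  have hasSum {s t : ℝ} (hst : s ≤ t) (μ : Measure Ω) [IsFiniteMeasure μ] :=
    hasSum_mgf_of_bound (μ := μ) (measurable_occupationTime hE.measurableSet s t).aemeasurable
      (.of_forall (abs_occupationTime_le E hst)) κ
  refine (hasSum (le_add_of_nonneg_right hr) (P.restrict (E s))).unique ?_
  simp only [hE.integral_occupationTime_pow_restrict hs hr, mul_left_comm _ (p s)]
  exact (hasSum hr P).mul_left (p s)

theorem mgf_occupationTime_renewal (κ : ℝ) (ht : 0 ≤ t) :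
    mgf (occupationTime E 0 t) P κ =
      1 + κ * ∫ s in (0 : ℝ)..t, p s * mgf (occupationTime E 0 (t - s)) P κ := by
  rw [mgf_occupationTime hE.measurableSet P κ ht, probReal_univ]
  congr 2
  refine intervalIntegral.integral_congr fun s hs => ?_
  rw [uIcc_of_le ht] at hs
  simpa only [add_sub_cancel] using
    hE.mgf_occupationTime_restrict hs.1 (sub_nonneg.2 hs.2) κ

lemma antitoneOn_mgf (hκ : κ ≤ 0) :
    AntitoneOn (fun t => mgf (occupationTime E 0 t) P κ) (Ioi 0) :=
  (antitoneOn_mgf_occupationTime hE.measurableSet P hκ 0).mono Ioi_subset_Ici_self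

lemma integrableOn_exp_neg_mul_mgf (hκ : κ ≤ 0) (hl : 0 < l) :
    IntegrableOn (fun t => exp (-(l * t)) * mgf (occupationTime E 0 t) P κ) (Ioi 0) :=
  integrableOn_exp_neg_mul_mul_of_bound hl
    (aemeasurable_restrict_of_antitoneOn measurableSet_Ioi
      (hE.antitoneOn_mgf hκ)).aestronglyMeasurable
    fun t ht => by
      rw [abs_of_nonneg mgf_nonneg]
      exact mgf_occupationTime_le_measureReal_univ E P hκ (mem_Ioi.1 ht).le

lemma integrableOn_exp_neg_mul (hl : 0 < l) :
    IntegrableOn (fun t => exp (-(l * t)) * p t) (Ioi 0) := by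
  have meas : Measurable fun t => P.real (E t) :=
    (measurable_measure_prodMk_left hE.measurableSet).ennreal_toReal
  refine integrableOn_exp_neg_mul_mul_of_bound hl (C := 1) (meas.aestronglyMeasurable.congr ?_)
    fun t ht => ?_
  · filter_upwards [ae_restrict_mem measurableSet_Ioi] with t ht
    exact hE.measureReal_eq (mem_Ioi.1 ht).le
  · rw [abs_of_nonneg (hE.nonneg (mem_Ioi.1 ht).le)]
    exact hE.le_one (mem_Ioi.1 ht).le

theorem laplaceTransform_mgf_occupationTime (hκ : κ ≤ 0) (hl : 0 < l) :
    laplaceTransform (fun t => mgf (occupationTime E 0 t) P κ) l =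
      l⁻¹ / (1 - κ * laplaceTransform p l) := by
  have renewal := laplaceTransform_eq_of_renewal hl (hE.integrableOn_exp_neg_mul hl)
    (hE.integrableOn_exp_neg_mul_mgf hκ hl)
    fun t ht => hE.mgf_occupationTime_renewal κ (mem_Ioi.1 ht).le
  have pos : 0 < 1 - κ * laplaceTransform p l := by nlinarith [hE.laplaceTransform_nonneg l]
  rw [eq_div_iff pos.ne']
  linear_combination renewal

theorem mgf_occupationTime_isEquivalent (hκ : κ ≤ 0) {ψ : ℝ → ℝ} {ρ : ℝ} (hρ : ρ < 1)
    (hψ : IsRegularlyVarying ψ ρ) (h : (fun t => 1 - κ * laplaceTransform p t⁻¹) ~[atTop] ψ) :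
    (fun t => mgf (occupationTime E 0 t) P κ) ~[atTop] fun t => 1 / (ψ t * Gamma (1 - ρ)) := by
  have laplace : (fun t => laplaceTransform (fun t => mgf (occupationTime E 0 t) P κ) t⁻¹)
      ~[atTop] fun t => t / ψ t := by
    refine (IsEquivalent.refl.div h).congr_left ?_
    filter_upwards [eventually_gt_atTop 0] with t ht
    rw [hE.laplaceTransform_mgf_occupationTime hκ (inv_pos.2 ht), inv_inv, Pi.div_apply]
  refine (isEquivalent_of_laplaceTransform_isEquivalent (sub_pos.2 hρ)
    (hE.antitoneOn_mgf hκ) (fun _ _ => mgf_nonneg)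
    (fun l hl => hE.integrableOn_exp_neg_mul_mgf hκ hl) (isRegularlyVarying_id.div hψ)
    laplace).congr_right ?_
  filter_upwards [eventually_ne_atTop 0] with t ht
  field_simp

end IsRegenerativePhenomenon

end Regenerative

section PowerLaw

namespace IsRegenerativePhenomenon

variable {Ω : Type*} [MeasurableSpace Ω] {P : Measure Ω} [IsProbabilityMeasure P] {p : ℝ → ℝ}
  {E : ℝ → Set Ω} (hE : IsRegenerativePhenomenon p P E) {c α κ : ℝ}
include hE

theorem mgf_occupationTime_isEquivalent_of_tendsto_atTop (hκ : κ < 0) {φ : ℝ → ℝ} {ρ : ℝ}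
    (hρ : ρ < 1) (hφ : IsRegularlyVarying φ ρ) (hφ_atTop : Tendsto φ atTop atTop)
    (h : (fun t => laplaceTransform p t⁻¹) ~[atTop] φ) :
    (fun t => mgf (occupationTime E 0 t) P κ) ~[atTop]
      fun t => 1 / (-κ * φ t * Gamma (1 - ρ)) := by
  have const_isLittleO : (fun _ => 1 : ℝ → ℝ) =o[atTop] fun t => -κ * φ t :=
    isLittleO_const_left.2 <| .inr <|
      tendsto_norm_atTop_atTop.comp (hφ_atTop.const_mul_atTop (neg_pos.2 hκ))
  refine hE.mgf_occupationTime_isEquivalent hκ.le hρ (hφ.const_mul (neg_ne_zero.2 hκ.ne)) ?_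
  refine ((IsEquivalent.refl (u := fun _ => -κ)).mul h |>.add_isLittleO const_isLittleO).congr_left
    (.of_forall fun t => ?_)
  simp only [Pi.add_apply, Pi.mul_apply]
  ring

theorem mgf_occupationTime_isEquivalent_rpow (hκ : κ < 0) (hc : 0 < c) (hα : 0 < α) (hα_lt : α < 1)
    (hp : p ~[atTop] fun t => c * t ^ (-α)) :
    (fun t => mgf (occupationTime E 0 t) P κ) ~[atTop]
      fun t => 1 / t ^ (1 - α) * (1 / (-κ * c * Gamma (1 - α) * Gamma α)) := by
  have laplace := laplaceTransform_isEquivalent_rpow hc (neg_lt_neg hα_lt)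
    (fun l hl => hE.integrableOn_exp_neg_mul hl) hp
  have coeff_pos : 0 < c * Gamma (1 + -α) := mul_pos hc (Gamma_pos_of_pos (by linarith))
  refine (hE.mgf_occupationTime_isEquivalent_of_tendsto_atTop hκ (by linarith)
    ((isRegularlyVarying_rpow _).const_mul coeff_pos.ne')
    ((tendsto_rpow_atTop (by linarith)).const_mul_atTop coeff_pos) laplace).congr_right
    (.of_forall fun t => ?_)
  simp only [← sub_eq_add_neg, sub_sub_cancel]
  field_simp

theorem mgf_occupationTime_isEquivalent_inv_log (hκ : κ < 0) (hc : 0 < c)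
    (hp : p ~[atTop] fun t => c * t⁻¹) :
    (fun t => mgf (occupationTime E 0 t) P κ) ~[atTop] fun t => 1 / log t * (1 / (-κ * c)) := by
  have laplace := laplaceTransform_isEquivalent_log hc
    (fun l hl => hE.integrableOn_exp_neg_mul hl) hp
  refine (hE.mgf_occupationTime_isEquivalent_of_tendsto_atTop hκ one_pos
    (isRegularlyVarying_log.const_mul hc.ne') (tendsto_log_atTop.const_mul_atTop hc)
    laplace).congr_right (.of_forall fun t => ?_)
  simp only [sub_zero, Gamma_one]
  field_simp

theorem mgf_occupationTime_isEquivalent_const (hκ : κ ≤ 0) (hp : IntegrableOn p (Ioi 0)) :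
    (fun t => mgf (occupationTime E 0 t) P κ) ~[atTop]
      fun _ => 1 / (1 - κ * ∫ t in Ioi 0, p t) := by
  have integral_nonneg : 0 ≤ ∫ t in Ioi 0, p t :=
    setIntegral_nonneg measurableSet_Ioi fun t ht => hE.nonneg (mem_Ioi.1 ht).le
  have pos : 0 < 1 - κ * ∫ t in Ioi 0, p t := by nlinarith
  have laplace : (fun t => 1 - κ * laplaceTransform p t⁻¹) ~[atTop]
      fun _ => 1 - κ * ∫ t in Ioi 0, p t :=
    (isEquivalent_const_iff_tendsto pos.ne').2
      (((tendsto_laplaceTransform_inv_atTop hp).const_mul κ).const_sub 1)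
  simpa only [sub_zero, Gamma_one, mul_one] using
    hE.mgf_occupationTime_isEquivalent hκ one_pos (isRegularlyVarying_const pos.ne') laplace

end IsRegenerativePhenomenon

theorem mainTheorem10_general {Ω : Type*} [MeasurableSpace Ω] (P : Measure Ω)
    [IsProbabilityMeasure P] (p : ℝ → ℝ) (E : ℝ → Set Ω) (hE : IsRegenerativePhenomenon p P E)
    (c α κ : ℝ) (hc : 0 < c) (hα : 0 < α) (hκ : κ < 0) (hp : p ~[atTop] fun t => c * t ^ (-α)) :
    (∀ t, 0 ≤ t → Integrable (fun ω => exp (κ * occupationTime E 0 t ω)) P) ∧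
    (α < 1 →
      (fun t => ∫ ω, exp (κ * occupationTime E 0 t ω) ∂P) ~[atTop]
        fun t => 1 / t ^ (1 - α) * (1 / (-κ * c * Gamma (1 - α) * Gamma α))) ∧
    (α = 1 →
      (fun t => ∫ ω, exp (κ * occupationTime E 0 t ω) ∂P) ~[atTop]
        fun t => 1 / log t * (1 / (-κ * c))) ∧
    (1 < α →
      ∫⁻ t in Ioi 0, ENNReal.ofReal (p t) ≠ ∞ ∧
      (fun t => ∫ ω, exp (κ * occupationTime E 0 t ω) ∂P) ~[atTop]
        fun _ => 1 / (1 - κ * (∫⁻ t in Ioi 0, ENNReal.ofReal (p t)).toReal)) := by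
  refine ⟨fun t ht => integrable_exp_mul_of_mem_Icc
      (measurable_occupationTime hE.measurableSet 0 t).aemeasurable
      (.of_forall (occupationTime_mem_Icc E ht)),
    fun hα_lt => hE.mgf_occupationTime_isEquivalent_rpow hκ hc hα hα_lt hp,
    fun hα_eq => hE.mgf_occupationTime_isEquivalent_inv_log hκ hc ?_, fun hα_gt => ?_⟩
  · simpa only [hα_eq, rpow_neg_one] using hp
  · have integrable := integrableOn_Ioi_of_isEquivalent_rpow (neg_lt_neg hα_gt)
      (fun l hl => hE.integrableOn_exp_neg_mul hl) hp
    rw [← integral_eq_lintegral_of_nonneg_ae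
      ((ae_restrict_mem measurableSet_Ioi).mono fun t ht => hE.nonneg (mem_Ioi.1 ht).le)
      integrable.aestronglyMeasurable]
    exact ⟨integrable.lintegral_lt_top.ne,
      hE.mgf_occupationTime_isEquivalent_const hκ.le integrable⟩

end PowerLaw

section MarkovProcess

variable {S Ω : Type*} [MeasurableSpace S] [MeasurableSingletonClass S] [MeasurableSpace Ω]
  {P : Measure Ω} {a : S → S → ℝ} {p : ℝ≥0 → S → S → ℝ} {i : S} {X : ℝ≥0 → Ω → S}

lemma IsMarkovProcess.ae_zero_eq [IsProbabilityMeasure P] (hX : IsMarkovProcess a p i P X) :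
    ∀ᵐ ω ∂P, X 0 ω = i := by
  have prob_eq_one : P.real {ω | X 0 ω = i} = 1 := by
    simpa using hX.finiteDim 0 (fun _ => 0) (fun _ => i) monotone_const rfl
  have meas : MeasurableSet {ω | X 0 ω = i} :=
    (hX.measurable.comp measurable_prodMk_left) (measurableSet_singleton i)
  exact (mem_ae_iff_prob_eq_one meas).2 ((ENNReal.toReal_eq_one_iff _).1 prob_eq_one)

theorem IsMarkovProcess.isRegenerativePhenomenon [IsProbabilityMeasure P]
    (hX : IsMarkovProcess a p i P X) :
    IsRegenerativePhenomenon (fun t => p t.toNNReal i i) P fun t => X t.toNNReal ⁻¹' {i} where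
  measurableSet := (hX.measurable.comp (by fun_prop : Measurable fun z : ℝ × Ω =>
    (z.1.toNNReal, z.2))) (measurableSet_singleton i)
  measureReal_iInter n t ht ht_mono := by
    have nonneg (k) : 0 ≤ t k := ht.trans (ht_mono (Fin.zero_le k))
    have sub_eq (k : Fin n) : (t k.succ - t k.castSucc).toNNReal =
        (t k.succ).toNNReal - (t k.castSucc).toNNReal := by
      rw [NNReal.sub_def, coe_toNNReal _ (nonneg _), coe_toNNReal _ (nonneg _)]
    have finiteDim : P.real {ω | ∀ k, X (Matrix.vecCons 0 (fun k => (t k).toNNReal) k) ω = i} =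
        p (t 0).toNNReal i i * ∏ k : Fin n, p (t k.succ - t k.castSucc).toNNReal i i := by
      simpa [Fin.prod_univ_succ (n := n), sub_eq] using hX.finiteDim (n + 1) _ (fun _ => i)
        (monotone_vecCons.2 ⟨zero_le, fun _ _ hjk => toNNReal_le_toNNReal (ht_mono hjk)⟩) rfl
    rw [← finiteDim]
    refine measureReal_congr (eventuallyEq_set.2 ?_)
    filter_upwards [hX.ae_zero_eq] with ω hω
    simp [Fin.forall_fin_succ (n := n + 1), hω]

end MarkovProcess

end

lemma isEquivalent_comp_toNNReal {f : ℝ≥0 → ℝ} {g : ℝ → ℝ} (h : f ~[atTop] fun t : ℝ≥0 => g t) :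
    (fun t : ℝ => f t.toNNReal) ~[atTop] g := by
  refine (h.comp_tendsto tendsto_real_toNNReal_atTop).congr_right ?_
  filter_upwards [eventually_ge_atTop 0] with t ht
  rw [Function.comp_apply, Real.coe_toNNReal t ht]

theorem mainTheorem10 {S Ω : Type*} [Countable S] [MeasurableSpace S] [DiscreteMeasurableSpace S]
    [MeasurableSpace Ω] (P : Measure Ω) [IsProbabilityMeasure P]
    (a : S → S → ℝ) (p : ℝ≥0 → S → S → ℝ) (i : S) (X : ℝ≥0 → Ω → S)
    (hX : IsMarkovProcess a p i P X)
    (c α κ : ℝ) (hc : 0 < c) (hα : 0 < α) (hκ : κ < 0)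
    (hp : (fun t : ℝ≥0 => p t i i) ~[atTop] (fun t : ℝ≥0 => c * (t : ℝ) ^ (-α))) :
    (∀ t : ℝ≥0, Integrable (fun ω => Real.exp (κ * localTime X i t ω)) P) ∧
    (α < 1 →
      (fun t : ℝ≥0 => ∫ ω, Real.exp (κ * localTime X i t ω) ∂P) ~[atTop]
        (fun t : ℝ≥0 => 1 / (t : ℝ) ^ (1 - α) *
          (1 / (-κ * c * Real.Gamma (1 - α) * Real.Gamma α)))) ∧
    (α = 1 →
      (fun t : ℝ≥0 => ∫ ω, Real.exp (κ * localTime X i t ω) ∂P) ~[atTop]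
        (fun t : ℝ≥0 => 1 / Real.log (t : ℝ) * (1 / (-κ * c)))) ∧
    (1 < α →
      greenFunction p i i ≠ ∞ ∧
      (fun t : ℝ≥0 => ∫ ω, Real.exp (κ * localTime X i t ω) ∂P) ~[atTop]
        (fun _ : ℝ≥0 => 1 / (1 - κ * (greenFunction p i i).toReal))) := by
  obtain ⟨integrable, rpow, log, const⟩ := mainTheorem10_general P _ _ hX.isRegenerativePhenomenon
    c α κ hc hα hκ (isEquivalent_comp_toNNReal (f := fun t => p t i i) hp)
  have coe_atTop : Tendsto ((↑) : ℝ≥0 → ℝ) atTop atTop := NNReal.tendsto_coe_atTop.2 tendsto_id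
  exact ⟨fun t => integrable t t.2, fun h => (rpow h).comp_tendsto coe_atTop,
    fun h => (log h).comp_tendsto coe_atTop,
    fun h => (const h).imp_right (·.comp_tendsto coe_atTop)⟩
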